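/- **Proposition 3.3.** Let $G$ be a graph isomorphic to one of the following five graphs. * $C_7$, the cycle on $7$ vertices. * $P_{10}$, the graph on $\{1,\dots,10\}$ with the $12$ edges $\{1,2\}$, $\{2,3\}$, $\{3,4\}$, $\{4,5\}$, $\{1,5\}$, $\{3,6\}$, $\{6,7\}$, $\{7,8\}$, $\{4,8\}$, $\{2,9\}$, $\{9,10\}$, $\{8,10\}$. * $P_{13}$, the graph on $\{1,\dots,13\}$ with the $17$ edges $\{1,7\}$, $\{1,8\}$, $\{2,4\}$, $\{2,3\}$, $\{4,5\}$, $\{5,6\}$, $\{3,6\}$, $\{4,7\}$, $\{6,8\}$, $\{5,10\}$, $\{7,9\}$, $\{9,10\}$, $\{10,11\}$, $\{8,11\}$, $\{11,13\}$, $\{12,13\}$, $\{9,12\}$. * $P_{14}$, the graph on the $14$ vertices $a_i, b_i$ ($i\in\mathbb Z/7$) with the $21$ edges $\{a_i,a_{i+1}\}$, $\{a_i,b_i\}$, $\{b_i,b_{i+2}\}$ ($i\in\mathbb Z/7$). * $Q_{13}$, the graph on $\{1,\dots,13\}$ with the $18$ edges $\{1,2\}$, $\{1,9\}$, $\{2,11\}$,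 $\{1,4\}$, $\{2,3\}$, $\{3,5\}$, $\{4,7\}$, $\{5,6\}$, $\{6,7\}$, $\{5,9\}$, $\{7,11\}$, $\{6,8\}$, $\{8,10\}$, $\{9,10\}$, $\{10,11\}$, $\{9,12\}$, $\{11,13\}$, $\{12,13\}$. Then, for every field $k$ of characteristic zero, the independence complex $I(G)$, i.e. the simplicial complex whose faces are the independent sets of $G$, is not Cohen–Macaulay over $k$. Here a simplicial complex $\Delta$ of dimension $d-1$ on a finite vertex set $V$ is Cohen–Macaulay over $k$ if, for some linear system of parameters $\theta_1,\dots,\theta_d$ of the face ring $k[\Delta]$, $$\dim_k\bigl(k[\Delta]/(\theta_1,\dots,\theta_d)\bigr)_i=h_i\qquad\text{for all }0\le i\le d,$$ where $k[\Delta]$ is the quotient of $k[x_v : v\in V]$, with its standard grading, by the ideal generated by the squarefree monomials $\prod_{v\in\sigma}x_v$ with $\sigma\subseteq V$, $\sigma\notin\Delta$; a linear system of parameters is a sequence $\theta_1,\dots,\theta_d\in k[\Delta]_1$ such that $k[\Delta]/(\theta_1,\dots,\theta_d)$ is a finite-dimensional $k$-vector space; and $h_0,\dots,h_d$ are defined by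 $\sum_{i=0}^d h_ix^i=\sum_{i=0}^d f_{i-1}x^i(1-x)^{d-i}$, with $f_{i-1}$ the number of faces of $\Delta$ having $i$ elements. -/

import Mathlib

namespace FlagComplex

/-- A simplicial complex on the vertex set `V`: a set of finite subsets of `V` (the faces) which is
closed under inclusion. The empty set is a face of every complex that has a face. -/
abbrev SComplex (V : Type*) := LowerSet (Finset V)

section Complexes

variable {V : Type*}

/-- The independence complex `I(G)`: its faces are the independent sets of `G`. -/
def indepComplex (G : SimpleGraph V) : SComplex V where
  carrier := {s | G.IsIndepSet (s : Set V)}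
  lower' := fun _ _ hts hs => Set.Pairwise.mono (Finset.coe_subset.mpr hts) hs

/-- The number `d` for which the complex has dimension `d - 1`, i.e. the maximal number of
vertices of a face (`V` is finite in all uses). -/
noncomputable def size (Δ : SComplex V) : ℕ :=
  sSup (Finset.card '' (Δ : Set (Finset V)))

/-- The face number `f_{i-1}`: the number of faces with `i` vertices, i.e. of dimension `i - 1`. -/
noncomputable def faceNumber (Δ : SComplex V) (i : ℕ) : ℕ :=
  {s : Finset V | s ∈ Δ ∧ s.card = i}.ncard

open Polynomial in
/-- The `h`-polynomial `∑_{i=0}^d f_{i-1} x^i (1-x)^{d-i}`, where `d - 1` is the dimension. -/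
noncomputable def hPoly (Δ : SComplex V) : ℤ[X] :=
  ∑ i ∈ Finset.range (size Δ + 1), C (faceNumber Δ i : ℤ) * X ^ i * (1 - X) ^ (size Δ - i)

/-- The entry `h_i` of the `h`-vector. -/
noncomputable def hNumber (Δ : SComplex V) (i : ℕ) : ℤ := (hPoly Δ).coeff i

end Complexes

section CohenMacaulay

variable {V : Type*} (k : Type*) [Field k]

/-- The Stanley-Reisner ideal: generated by the squarefree monomials of the non-faces. -/
noncomputable def srIdeal (Δ : SComplex V) : Ideal (MvPolynomial V k) :=
  Ideal.span {m | ∃ s : Finset V, s ∉ Δ ∧ m = ∏ v ∈ s, MvPolynomial.X v}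

/-- The Stanley-Reisner ring (face ring) `k[Δ]`. -/
abbrev SRRing (Δ : SComplex V) := MvPolynomial V k ⧸ srIdeal k Δ

/-- The homogeneous component `k[Δ]_i`: the image of the forms of degree `i`. -/
noncomputable def srDegree (Δ : SComplex V) (i : ℕ) : Submodule k (SRRing k Δ) :=
  (MvPolynomial.homogeneousSubmodule V k i).map
    (Ideal.Quotient.mkₐ k (srIdeal k Δ)).toLinearMap

/-- The quotient `k[Δ] / (θ_1, …, θ_d)`. -/
abbrev SRQuotient (Δ : SComplex V) {d : ℕ} (θ : Fin d → SRRing k Δ) :=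
  SRRing k Δ ⧸ Ideal.span (Set.range θ)

/-- The homogeneous component `(k[Δ] / (θ_1, …, θ_d))_i`: the image of `k[Δ]_i`. -/
noncomputable def srQuotientDegree (Δ : SComplex V) {d : ℕ} (θ : Fin d → SRRing k Δ) (i : ℕ) :
    Submodule k (SRQuotient k Δ θ) :=
  (srDegree k Δ i).map (Ideal.Quotient.mkₐ k (Ideal.span (Set.range θ))).toLinearMap

/-- `θ_1, …, θ_d` is a linear system of parameters of `k[Δ]`, where `dim Δ = d - 1`: the `θ_j`
are elements of `k[Δ]_1` and `k[Δ] / (θ_1, …, θ_d)` is a finite-dimensional `k`-vector space. -/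
def IsLSOP (Δ : SComplex V) (θ : Fin (size Δ) → SRRing k Δ) : Prop :=
  (∀ j, θ j ∈ srDegree k Δ 1) ∧ Module.Finite k (SRQuotient k Δ θ)

/-- `Δ` is Cohen-Macaulay over `k`: for some linear system of parameters `θ_1, …, θ_d`,
`dim_k (k[Δ] / (θ_1, …, θ_d))_i = h_i` for all `0 ≤ i ≤ d`. -/
def IsCohenMacaulay (Δ : SComplex V) : Prop :=
  ∃ θ : Fin (size Δ) → SRRing k Δ, IsLSOP k Δ θ ∧
    ∀ i ≤ size Δ, (Module.finrank k (srQuotientDegree k Δ θ i) : ℤ) = hNumber Δ i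

end CohenMacaulay

section Graphs

/-- The graph `P_10`; the vertex `i` here is the one labelled `i + 1` in its usual drawing. -/
def P10 : SimpleGraph (Fin 10) := SimpleGraph.fromEdgeSet (({
  s(0, 1), s(1, 2), s(2, 3), s(3, 4), s(4, 0), s(2, 5), s(5, 6), s(6, 7), s(3, 7),
  s(1, 8), s(8, 9), s(7, 9)} : Finset (Sym2 (Fin 10))) : Set (Sym2 (Fin 10)))

/-- The graph `P_13`; the vertex `i` here is the one labelled `i + 1` in its usual drawing. -/
def P13 : SimpleGraph (Fin 13) := SimpleGraph.fromEdgeSet (({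
  s(0, 6), s(0, 7), s(1, 3), s(1, 2), s(3, 4), s(4, 5), s(2, 5), s(3, 6), s(5, 7), s(4, 9),
  s(6, 8), s(8, 9), s(9, 10), s(7, 10), s(10, 12), s(11, 12), s(8, 11)} :
  Finset (Sym2 (Fin 13))) : Set (Sym2 (Fin 13)))

/-- The graph `P_14`: an outer 7-cycle on `0, …, 6`, an inner 7-cycle on `7, …, 13` joining
`7 + i` to `7 + (i + 2 mod 7)`, and the spokes from `i` to `7 + i`. -/
def P14 : SimpleGraph (Fin 14) := SimpleGraph.fromEdgeSet (({
  s(0, 1), s(1, 2), s(2, 3), s(3, 4), s(4, 5), s(5, 6), s(6, 0),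
  s(0, 7), s(1, 8), s(2, 9), s(3, 10), s(4, 11), s(5, 12), s(6, 13),
  s(8, 10), s(10, 12), s(12, 7), s(7, 9), s(9, 11), s(11, 13), s(13, 8)} :
  Finset (Sym2 (Fin 14))) : Set (Sym2 (Fin 14)))

/-- The graph `Q_13`; the vertices are numbered row by row from the bottom of its usual drawing. -/
def Q13 : SimpleGraph (Fin 13) := SimpleGraph.fromEdgeSet (({
  s(0, 1), s(0, 8), s(1, 10), s(0, 3), s(1, 2), s(2, 4), s(3, 6), s(4, 5), s(5, 6), s(4, 8),
  s(6, 10), s(5, 7), s(7, 9), s(8, 9), s(9, 10), s(8, 11), s(10, 12), s(11, 12)} :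
  Finset (Sym2 (Fin 13))) : Set (Sym2 (Fin 13)))

end Graphs

end FlagComplex

/-! The `h`-vector of a Cohen-Macaulay complex consists of dimensions of vector spaces, so it has no
negative entry. For each of the five graphs the last entry
`h_d = ∑ i ≤ d, (-1) ^ (d - i) f_{i-1}` (up to sign, the reduced Euler characteristic of `I(G)`)
equals `-1`, so `I(G)` is not Cohen-Macaulay, over any field.

The face numbers `f_{i-1}` are found from the deletion-contraction recursion for independent sets:
an independent set of `G` either avoids the vertex `v`, or consists of `v` and an independent set of
`G` without `v` and its neighbours (`card_indepSets`). This recursion visits the independent sets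
only, rather than all sets of vertices, which makes it cheap enough to be evaluated by the kernel.
-/

namespace FlagComplex

/-! ### Nonnegativity of the `h`-vector -/

theorem IsCohenMacaulay.hNumber_nonneg {V k : Type*} [Field k] {Δ : SComplex V}
    (h : IsCohenMacaulay k Δ) {i : ℕ} (hi : i ≤ size Δ) : 0 ≤ hNumber Δ i := by
  obtain ⟨θ, -, hθ⟩ := h
  exact hθ i hi ▸ Int.natCast_nonneg _

open Polynomial in
theorem hNumber_size {V : Type*} (Δ : SComplex V) :
    hNumber Δ (size Δ) =
      ∑ i ∈ Finset.range (size Δ + 1), (faceNumber Δ i : ℤ) * (-1) ^ (size Δ - i) := by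
  have key (n : ℕ) : ((1 - X : ℤ[X]) ^ n).coeff n = (-1) ^ n := by
    have h : (1 - X : ℤ[X]) = C (-1) * X + C 1 := by simp [sub_eq_neg_add]
    have hn := coeff_pow_of_natDegree_le (m := n) (natDegree_linear_le (a := (-1 : ℤ)) (b := 1))
    rw [Nat.mul_one] at hn
    rw [h, hn, coeff_add, coeff_C_mul, coeff_X_one, coeff_C_succ, mul_one, add_zero]
  unfold hNumber hPoly
  rw [finsetSum_coeff]
  refine Finset.sum_congr rfl fun i hi => ?_
  have hi' : i ≤ size Δ := Nat.lt_succ_iff.mp (Finset.mem_range.mp hi)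
  rw [mul_assoc, coeff_C_mul, coeff_X_pow_mul', if_pos hi', key]

/-! ### Face numbers of independence complexes -/

theorem faceNumber_indepComplex_congr {V W : Type*} {G : SimpleGraph V} {H : SimpleGraph W}
    (e : G ≃g H) (i : ℕ) :
    faceNumber (indepComplex G) i = faceNumber (indepComplex H) i := by
  refine Set.ncard_congr (fun s _ => s.map e.toEquiv.toEmbedding) ?_
    (fun s t _ _ h => Finset.map_injective _ h) ?_
  · rintro s ⟨hs, rfl⟩
    refine ⟨?_, Finset.card_map _⟩
    change H.IsIndepSet _
    intro a ha b hb hab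
    simp only [Finset.coe_map, Set.mem_image] at ha hb
    obtain ⟨a, ha, rfl⟩ := ha
    obtain ⟨b, hb, rfl⟩ := hb
    have := hs ha hb (fun h => hab (h ▸ rfl))
    exact fun h => this (e.map_adj_iff.mp h)
  · rintro t ⟨ht, rfl⟩
    refine ⟨t.map e.symm.toEquiv.toEmbedding, ⟨?_, Finset.card_map _⟩, ?_⟩
    · change G.IsIndepSet _
      intro a ha b hb hab
      simp only [Finset.coe_map, Set.mem_image] at ha hb
      obtain ⟨a, ha, rfl⟩ := ha
      obtain ⟨b, hb, rfl⟩ := hb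
      have := ht ha hb (fun h => hab (h ▸ rfl))
      exact fun h => this (e.symm.map_adj_iff.mp h)
    · rw [Finset.map_map]
      convert Finset.map_refl
      ext x
      exact e.apply_symm_apply x

/-- The face numbers determine the size: since the complex is closed under inclusion, a single
vanishing face number bounds the cardinality of all faces. -/
theorem size_eq_of_faceNumber {V : Type*} [Finite V] {Δ : SComplex V} {d : ℕ}
    (hd : faceNumber Δ d ≠ 0) (hd' : faceNumber Δ (d + 1) = 0) : size Δ = d := by
  have hmax : ∀ s ∈ Δ, s.card ≤ d := by
    intro s hs
    by_contra! hlt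
    obtain ⟨t, hts, ht⟩ := Finset.exists_subset_card_eq (Nat.succ_le_of_lt hlt)
    have hemp := (Set.ncard_eq_zero (Set.toFinite _)).mp hd'
    exact Set.eq_empty_iff_forall_notMem.mp hemp t ⟨Δ.lower hts hs, ht⟩
  obtain ⟨s, hs, rfl⟩ := Set.nonempty_of_ncard_ne_zero hd
  refine IsGreatest.csSup_eq ⟨⟨s, hs, rfl⟩, ?_⟩
  rintro _ ⟨t, ht, rfl⟩
  exact hmax t ht

/-- The number of `i`-element independent sets among the vertices listed in `l`, by deletion and
contraction of the first vertex `v`: the independent sets that contain `v` correspond to those among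
the later vertices that are not adjacent to `v`. The recursion is structural, in `i` and then in
`l`, so that it can be evaluated by reduction. -/
def indepCount {V : Type*} (G : SimpleGraph V) [DecidableRel G.Adj] : ℕ → List V → ℕ
  | 0, _ => 1
  | i + 1, l => l.rec 0 fun v t c => c + indepCount G i (t.filter fun w => ¬ G.Adj v w)

theorem indepCount_succ_cons {V : Type*} (G : SimpleGraph V) [DecidableRel G.Adj] (i : ℕ) (v : V)
    (l : List V) : indepCount G (i + 1) (v :: l) =
      indepCount G (i + 1) l + indepCount G i (l.filter fun w => ¬ G.Adj v w) := rfl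

theorem card_indepSets {V : Type*} [DecidableEq V] (G : SimpleGraph V) [DecidableRel G.Adj]
    (i : ℕ) (l : List V) (hl : l.Nodup) :
    {s : Finset V | s ⊆ l.toFinset ∧ G.IsIndepSet (s : Set V) ∧ s.card = i}.ncard =
      indepCount G i l := by
  induction i generalizing l with
  | zero =>
    rw [indepCount, Set.ncard_eq_one]
    refine ⟨∅, Set.ext fun s => ?_⟩
    simp only [Finset.card_eq_zero, Set.mem_ofPred_eq, Set.mem_singleton_iff]
    refine ⟨fun h => h.2.2, ?_⟩
    rintro rfl
    simp [SimpleGraph.IsIndepSet]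
  | succ i ihi =>
    induction l with
    | nil =>
      refine (congrArg Set.ncard (Set.eq_empty_iff_forall_notMem.mpr fun s hs => ?_)).trans
        (Set.ncard_empty _)
      have h : s = ∅ := by simpa using hs.1
      simpa [h] using hs.2.2
    | cons v l ihl =>
      obtain ⟨hv, hl⟩ := List.nodup_cons.mp hl
      rw [indepCount_succ_cons, ← ihl hl, ← ihi _ (hl.filter _)]
      have hinj : Set.InjOn (insert v : Finset V → Finset V) {s : Finset V |
          s ⊆ (l.filter fun w => ¬ G.Adj v w).toFinset ∧ G.IsIndepSet (s : Set V) ∧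
            s.card = i} := by
        intro s hs t ht hst
        have hvs : v ∉ s := fun h => hv (List.mem_of_mem_filter (List.mem_toFinset.mp (hs.1 h)))
        have hvt : v ∉ t := fun h => hv (List.mem_of_mem_filter (List.mem_toFinset.mp (ht.1 h)))
        rw [← Finset.erase_insert hvs, ← Finset.erase_insert hvt, hst]
      have hfin (m : List V) (j : ℕ) :
          {s : Finset V | s ⊆ m.toFinset ∧ G.IsIndepSet (s : Set V) ∧ s.card = j}.Finite :=
        (Finset.finite_toSet m.toFinset.powerset).subset fun s hs =>
          Finset.mem_powerset.mpr hs.1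
      rw [← hinj.ncard_image, ← Set.ncard_union_eq _ (hfin _ _) ((hfin _ _).image _)]
      · congr 1
        ext s
        simp only [Set.mem_ofPred_eq, Set.mem_union, Set.mem_image]
        constructor
        · rintro ⟨hs, hind, hcard⟩
          by_cases hvs : v ∈ s
          · refine Or.inr ⟨s.erase v, ⟨fun w hw => ?_, hind.mono (by simp), ?_⟩,
              Finset.insert_erase hvs⟩
            · obtain ⟨hne, hw⟩ := Finset.mem_erase.mp hw
              have hwl := hs hw
              have := hind hvs hw hne.symm
              simp_all
            · rw [Finset.card_erase_of_mem hvs, hcard, Nat.add_sub_cancel]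
          · refine Or.inl ⟨fun w hw => ?_, hind, hcard⟩
            have hwl := hs hw
            have hne : w ≠ v := fun h => hvs (h ▸ hw)
            simp_all
        · rintro (⟨hs, hind, hcard⟩ | ⟨s, ⟨hs, hind, rfl⟩, rfl⟩)
          · exact ⟨fun w hw => by simpa using Or.inr (List.mem_toFinset.mp (hs hw)), hind, hcard⟩
          · have hs' (w) (hw : w ∈ s) : w ∈ l ∧ ¬ G.Adj v w := by simpa using hs hw
            refine ⟨fun w hw => ?_, ?_, Finset.card_insert_of_notMem fun h => hv (hs' v h).1⟩
            · rcases Finset.mem_insert.mp hw with rfl | hw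
              · simp
              · simp [(hs' w hw).1]
            · rw [Finset.coe_insert]
              exact hind.insert fun w hw _ =>
                ⟨(hs' w hw).2, fun h => (hs' w hw).2 h.symm⟩
      · refine Set.disjoint_left.mpr fun s hs hs' => ?_
        obtain ⟨t, -, rfl⟩ := hs'
        exact hv (List.mem_toFinset.mp (hs.1 (Finset.mem_insert_self v t)))

theorem faceNumber_indepComplex_fin {n : ℕ} (G : SimpleGraph (Fin n)) [DecidableRel G.Adj]
    (i : ℕ) : faceNumber (indepComplex G) i = indepCount G i (List.finRange n) := by
  rw [← card_indepSets G i _ (List.nodup_finRange n)]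
  unfold faceNumber
  congr 1
  ext s
  simp only [Set.mem_ofPred_eq, List.toFinset_finRange, Finset.subset_univ, true_and]
  rfl

/-- The first two counts say that `d` is the maximal size of an independent set; the alternating sum
is then the last entry `h_d` of the `h`-vector. -/
theorem not_isCohenMacaulay_of_indepCount {V : Type*} {n : ℕ} {G : SimpleGraph V}
    {H : SimpleGraph (Fin n)} [DecidableRel H.Adj] (e : G ≃g H) (k : Type*) [Field k] (d : ℕ)
    (hd : indepCount H d (List.finRange n) ≠ 0)
    (hd' : indepCount H (d + 1) (List.finRange n) = 0)
    (hneg : ∑ i ∈ Finset.range (d + 1),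
      (indepCount H i (List.finRange n) : ℤ) * (-1) ^ (d - i) < 0) :
    ¬ IsCohenMacaulay k (indepComplex G) := by
  intro h
  have : Finite V := Finite.of_equiv _ e.toEquiv.symm
  have hface (i : ℕ) :
      faceNumber (indepComplex G) i = indepCount H i (List.finRange n) := by
    rw [faceNumber_indepComplex_congr e, faceNumber_indepComplex_fin]
  have hsize : size (indepComplex G) = d :=
    size_eq_of_faceNumber (by rwa [hface]) (by rwa [hface])
  have hnonneg := h.hNumber_nonneg le_rfl
  rw [hNumber_size, hsize] at hnonneg
  simp only [hface] at hnonneg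
  exact hneg.not_ge hnonneg

/-! ### The five graphs -/

instance : DecidableRel P10.Adj := by unfold P10; infer_instance

instance : DecidableRel P13.Adj := by unfold P13; infer_instance

instance : DecidableRel P14.Adj := by unfold P14; infer_instance

instance : DecidableRel Q13.Adj := by unfold Q13; infer_instance

end FlagComplex

open FlagComplex in
theorem proposition3p3 {V : Type*} (G : SimpleGraph V)
    (hG : Nonempty (G ≃g SimpleGraph.cycleGraph 7) ∨ Nonempty (G ≃g FlagComplex.P10) ∨
      Nonempty (G ≃g FlagComplex.P13) ∨ Nonempty (G ≃g FlagComplex.P14) ∨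
      Nonempty (G ≃g FlagComplex.Q13))
    (k : Type*) [Field k] [CharZero k] :
    ¬ FlagComplex.IsCohenMacaulay k (FlagComplex.indepComplex G) := by
  -- The `h`-vectors are `(1, 4, 3, -1)`, `(1, 6, 9, 2, -1)`, `(1, 8, 19, 13, -1, -1)`,
  -- `(1, 9, 24, 18, -2, -1)` and `(1, 8, 18, 11, -1, -1)`.
  rcases hG with ⟨⟨e⟩⟩ | ⟨⟨e⟩⟩ | ⟨⟨e⟩⟩ | ⟨⟨e⟩⟩ | ⟨⟨e⟩⟩
  · exact not_isCohenMacaulay_of_indepCount e k 3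
      (by decide +kernel) (by decide +kernel) (by decide +kernel)
  · exact not_isCohenMacaulay_of_indepCount e k 4
      (by decide +kernel) (by decide +kernel) (by decide +kernel)
  · exact not_isCohenMacaulay_of_indepCount e k 5
      (by decide +kernel) (by decide +kernel) (by decide +kernel)
  · exact not_isCohenMacaulay_of_indepCount e k 5
      (by decide +kernel) (by decide +kernel) (by decide +kernel)
  · exact not_isCohenMacaulay_of_indepCount e k 5
      (by decide +kernel) (by decide +kernel) (by decide +kernel)
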